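/- Private information delivery (PID). Let $K,N,M$ be integers with $1\le M\le K$, and let $\mathbb F$ be a finite field. There are $K$ independent messages $W_1,\dots,W_K$, each consisting of $L\ge 1$ i.i.d. uniform symbols from $\mathbb F$, and $N$ servers; server $n$ stores the messages $W_i$, $i\in\mathcal S_n$, where $\mathcal S_n\subseteq\{1,\dots,K\}$ and $|\mathcal S_n|=M$. The servers share a discrete random variable $Z$ independent of all the messages. To deliver $W_k$, server $n$ sends an answer $A_n^{[k]}\in\mathbb F^{D_n}$ that is a function of $(W_i)_{i\in\mathcal S_n}$ and $Z$. A PID scheme (a choice of $L$, $\mathcal S_n$, $D_n$, $Z$ and $A_n^{[k]}$) must satisfy, for all $k$: $W_k$ is determined with zero error by $(A_1^{[k]},\dots,A_N^{[k]})$; and the joint distribution of $(A_1^{[k]},\dots,A_N^{[k]},W_k)$ does not depend on $k$. Its rate is $L/\sum_{n=1}^N D_n$. A rate $R$ is achievable if some PID scheme has rate at least $R$. Theorem 2. Suppose $K/M\notin\mathbb Z$ and $N\ge\lceil K/M\rceil$. (i) If $N\ \ge\ \frac{K}{\gcd(K,M)}-\Big(\frac{M}{\gcd(K,M)}-1\Big)\Big(\Big\lfloor\frac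 KM\Big\rfloor-1\Big)$, then the rate $M/K$ is achievable, and no larger rate is achievable. (ii) If $N=\lceil K/M\rceil$, then the rate $1/\lceil K/M\rceil$ is achievable, and no larger rate is achievable. -/

import Mathlib

open MeasureTheory ProbabilityTheory

/-- A private information delivery (PID) scheme for `K` messages of `L` symbols each from the
finite alphabet `F`, and `N` servers each storing `M` messages.
`S n` is the set of (indices of) the messages stored at server `n`, `D n` is the number of symbols
that server `n` sends, `W k` is the `k`-th message, `Z` is the (discrete) common randomness of the
servers, and `A k n` is the answer of server `n` when message `k` is to be delivered. All these are
random variables on the probability space `(Ω, μ)`. -/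
structure IsPIDScheme {F Ω 𝒵 : Type*} [MeasurableSpace F] [MeasurableSpace Ω] [MeasurableSpace 𝒵]
    (K N M L : ℕ) (μ : Measure Ω) (S : Fin N → Finset (Fin K)) (D : Fin N → ℕ)
    (W : Fin K → Ω → Fin L → F) (Z : Ω → 𝒵)
    (A : Fin K → (n : Fin N) → Ω → Fin (D n) → F) : Prop where
  /-- every server stores exactly `M` messages -/
  card_storage : ∀ n, (S n).card = M
  measurable_message : ∀ k, Measurable (W k)
  measurable_randomness : Measurable Z
  measurable_answer : ∀ k n, Measurable (A k n)
  /-- every message consists of `L` i.i.d. uniform symbols, i.e. is uniform on `F ^ L` -/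
  uniform_message : ∀ k, μ.map (W k) = uniformOn Set.univ
  /-- the messages are independent -/
  indep_messages : iIndepFun W μ
  /-- the common randomness is independent of the messages -/
  indep_randomness : IndepFun Z (fun ω k => W k ω) μ
  /-- the answer of a server is a function of the messages it stores and the common randomness -/
  answer_determined : ∀ k n, ∃ f : (S n → Fin L → F) → 𝒵 → Fin (D n) → F,
    ∀ᵐ ω ∂μ, A k n ω = f (fun i => W i ω) (Z ω)
  /-- the desired message is recovered from all the answers with zero error -/
  decodable : ∀ k, ∃ g : ((n : Fin N) → Fin (D n) → F) → Fin L → F,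
    ∀ᵐ ω ∂μ, g (fun n => A k n ω) = W k ω
  /-- privacy: the joint law of all the answers and the delivered message does not depend on
  which message is delivered -/
  privacy : ∀ j k, IdentDistrib (fun ω => ((fun n => A j n ω), W j ω))
    (fun ω => ((fun n => A k n ω), W k ω)) μ μ

/-- The rate `R` is achievable (with symbols from `F`) for `K` messages, `N` servers and `M`
messages per server: some PID scheme has rate `L / ∑ n, D n` at least `R`. The storage, the message
length, the answer lengths, the common randomness and the answers are all free to be chosen. -/
def PIDAchievable (F : Type*) [MeasurableSpace F] (K N M : ℕ) (R : ℝ) : Prop :=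
  ∃ (L : ℕ) (S : Fin N → Finset (Fin K)) (D : Fin N → ℕ)
    (Ω 𝒵 : Type) (_ : MeasurableSpace Ω) (_ : MeasurableSpace 𝒵)
    (μ : Measure Ω) (W : Fin K → Ω → Fin L → F) (Z : Ω → 𝒵)
    (A : Fin K → (n : Fin N) → Ω → Fin (D n) → F),
    1 ≤ L ∧ IsProbabilityMeasure μ ∧ Countable 𝒵 ∧ DiscreteMeasurableSpace 𝒵 ∧
    IsPIDScheme K N M L μ S D W Z A ∧
    R ≤ (L : ℝ) / ∑ n, (D n : ℝ)

/-! Converse: fix the common randomness and all messages but `W k`. Only the servers storing `k` can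
then react to `W k`, and their answers determine it, so they send at least `L` symbols together.
Summing over `k` counts each server `M` times and bounds the rate by `M / K`. If `N - 1` servers
cannot hold everything, each server is the only holder of some message and must send `L` symbols
itself.

Achievability: let `Z` be a uniform answer vector and `G` a fixed linear decoder. To deliver `W k`,
the servers storing `k` add a correction `x` with `G x = W k - G Z`. The answers are then uniform
with `G` of them equal to `W k`, whatever `k` is. A Vandermonde `G` over a large field admits such
corrections as soon as the holders of each message send `m` symbols together
(`pidAchievable_of_le_sum`), which leaves a storage design problem. -/

/-! ### The cut-set bound -/

/-- In a PID scheme the servers that store a message send at least as many symbols as the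
message has. -/
theorem IsPIDScheme.length_le {F Ω 𝒵 : Type*} [Finite F] [Nontrivial F] [MeasurableSpace F]
    [DiscreteMeasurableSpace F] [MeasurableSpace Ω] [MeasurableSpace 𝒵] [Countable 𝒵]
    [DiscreteMeasurableSpace 𝒵] {K N M L : ℕ} {μ : Measure Ω} [IsProbabilityMeasure μ]
    {S : Fin N → Finset (Fin K)} {D : Fin N → ℕ} {W : Fin K → Ω → Fin L → F} {Z : Ω → 𝒵}
    {A : Fin K → (n : Fin N) → Ω → Fin (D n) → F} (h : IsPIDScheme K N M L μ S D W Z A)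
    (k : Fin K) : L ≤ ∑ n with k ∈ S n, D n := by
  classical
  have := Fintype.ofFinite F
  choose f hf using h.answer_determined k
  obtain ⟨g, hg⟩ := h.decodable k
  have good : ∀ᵐ ω ∂μ, (∀ n, A k n ω = f n (fun i => W i ω) (Z ω)) ∧
      g (fun n => A k n ω) = W k ω := (ae_all_iff.2 hf).and hg
  obtain ⟨z, hz⟩ : ∃ z, μ (Z ⁻¹' {z}) ≠ 0 := by
    by_contra! hc
    have h0 : μ (⋃ z, Z ⁻¹' {z}) = 0 := measure_iUnion_null hc
    rw [← Set.preimage_iUnion, Set.iUnion_of_singleton, Set.preimage_univ, measure_univ] at h0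
    exact one_ne_zero h0
  -- Each `w` occurs jointly with `z` with positive probability, so the almost sure decoding
  -- identity holds at every `w`.
  have key : ∀ w : Fin K → Fin L → F, g (fun n => f n (fun i => w i) z) = w k := by
    intro w
    have hw : μ ((fun ω i => W i ω) ⁻¹' {w}) ≠ 0 := by
      have e : (fun ω i => W i ω) ⁻¹' {w} = ⋂ i ∈ Finset.univ, W i ⁻¹' {w i} := by
        ext ω
        simp [funext_iff]
      rw [e, h.indep_messages.measure_inter_preimage_eq_mul _
        (fun i _ => MeasurableSet.singleton _)]
      refine Finset.prod_ne_zero_iff.2 fun i _ => ?_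
      rw [← Measure.map_apply (h.measurable_message i) (MeasurableSet.singleton _),
        h.uniform_message i, uniformOn_univ, Measure.count_singleton]
      simp
    have hpos : μ (Z ⁻¹' {z} ∩ (fun ω i => W i ω) ⁻¹' {w}) ≠ 0 := by
      rw [h.indep_randomness.measure_inter_preimage_eq_mul _ _
        (MeasurableSet.singleton _) (MeasurableSet.singleton _)]
      exact mul_ne_zero hz hw
    obtain ⟨ω, ⟨hωz, hωw⟩, hA, hω⟩ := ((frequently_ae_mem_iff.2 hpos).and_eventually good).exists
    simp only [Set.mem_preimage, Set.mem_singleton_iff] at hωz hωw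
    subst hωz hωw
    simpa only [hA] using hω
  obtain ⟨c⟩ : Nonempty F := inferInstance
  let upd (w : Fin L → F) : Fin K → Fin L → F := Function.update (fun _ _ => c) k w
  let Φ (w : Fin L → F) (n : {n // k ∈ S n}) : Fin (D n) → F := f n (fun i => upd w i) z
  have hΦ : Function.Injective Φ := by
    intro w w' hww
    have e : (fun n => f n (fun i => upd w i) z) = fun n => f n (fun i => upd w' i) z := by
      funext n
      by_cases hn : k ∈ S n
      · exact congrFun hww ⟨n, hn⟩
      · congr 1
        funext i
        have hi : (i : Fin K) ≠ k := fun hi => hn (hi ▸ i.2)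
        simp [upd, hi]
    have h1 := key (upd w)
    rw [e, key (upd w')] at h1
    simpa [upd] using h1.symm
  have hcard := Fintype.card_le_of_injective Φ hΦ
  simp only [Fintype.card_pi, Finset.prod_const, Finset.card_univ, Fintype.card_fin] at hcard
  rw [Finset.prod_pow_eq_pow_sum, Nat.pow_le_pow_iff_right Fintype.one_lt_card] at hcard
  rwa [← Finset.sum_subtype_eq_sum_filter, Finset.subtype_univ]

/-! ### Schemes from linear decoders -/

/-- A linear recovery map that hits every value on the servers of each message yields a PID
scheme. -/
theorem pidAchievable_of_addMonoidHom {F : Type} [Finite F] [Nonempty F] [MeasurableSpace F]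
    [DiscreteMeasurableSpace F] {K N M L : ℕ} (hL : 1 ≤ L) (S : Fin N → Finset (Fin K))
    (hS : ∀ n, (S n).card = M) (D : Fin N → ℕ) {X : Fin N → Type*} [∀ n, AddCommGroup (X n)]
    {Y : Type*} [AddCommGroup Y] (eX : ∀ n, (Fin (D n) → F) ≃ X n) (eY : (Fin L → F) ≃ Y)
    (G : (∀ n, X n) →+ Y)
    (hG : ∀ k y, ∃ x : ∀ n, X n, (∀ n, k ∉ S n → x n = 0) ∧ G x = y) :
    PIDAchievable F K N M ((L : ℝ) / ∑ n, (D n : ℝ)) := by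
  classical
  have := Fintype.ofFinite F
  choose s hs0 hs using hG
  let νW : Measure (Fin L → F) := uniformOn Set.univ
  let νZ : Measure (∀ n, Fin (D n) → F) := uniformOn Set.univ
  have : IsProbabilityMeasure νW := isProbabilityMeasure_uniformOn Set.finite_univ Set.univ_nonempty
  have : IsProbabilityMeasure νZ := isProbabilityMeasure_uniformOn Set.finite_univ Set.univ_nonempty
  let μ : Measure ((Fin K → Fin L → F) × (∀ n, Fin (D n) → F)) := (Measure.pi fun _ => νW).prod νZ
  let e (z : ∀ n, Fin (D n) → F) : ∀ n, X n := fun n => eX n (z n)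
  let A (k : Fin K) (n : Fin N) (ω : (Fin K → Fin L → F) × (∀ n, Fin (D n) → F)) :
      Fin (D n) → F := (eX n).symm (e ω.2 n + s k (eY (ω.1 k) - G (e ω.2)) n)
  have hmap : ∀ k, μ.map (fun ω => ω.1 k) = νW := fun k =>
    ((measurePreserving_eval (fun _ => νW) k).comp measurePreserving_fst).map_eq
  refine ⟨L, S, D, _, _, _, _, μ, fun k ω => ω.1 k, Prod.snd, A, hL, inferInstance, inferInstance,
    inferInstance, ⟨hS, fun k => by fun_prop, by fun_prop, fun k n => .of_discrete, hmap, ?_, ?_,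
    ?_, ?_, ?_⟩, le_rfl⟩
  · rw [iIndepFun_iff_map_fun_eq_pi_map fun k => by fun_prop]
    simp only [hmap]
    exact measurePreserving_fst.map_eq
  · exact (indepFun_prod (μ := Measure.pi fun _ : Fin K => νW) (ν := νZ) measurable_id
      measurable_id).symm
  · intro k n
    by_cases hk : k ∈ S n
    · exact ⟨fun w z => (eX n).symm (e z n + s k (eY (w ⟨k, hk⟩) - G (e z)) n),
        Filter.Eventually.of_forall fun ω => rfl⟩
    · refine ⟨fun w z => z n, Filter.Eventually.of_forall fun ω => ?_⟩
      simp [A, e, hs0 _ _ _ hk]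
  · intro k
    refine ⟨fun a => eY.symm (G (e a)), Filter.Eventually.of_forall fun ω => ?_⟩
    have h1 : e (fun n => A k n ω) = e ω.2 + s k (eY (ω.1 k) - G (e ω.2)) := by
      funext n
      simp [e, A]
    simp [h1, hs]
  · intro j k
    let E : (∀ n, Fin (D n) → F) ≃ ∀ n, X n := Equiv.piCongrRight eX
    -- Swapping messages `j` and `k` and shifting the randomness turns `A j` into `A k`. The shift
    -- lies in the kernel of `G`, so the residual `W k - G Z` to be corrected is unchanged.
    let Ψ (j k : Fin K) (ω : (Fin K → Fin L → F) × (∀ n, Fin (D n) → F)) :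
        (Fin K → Fin L → F) × (∀ n, Fin (D n) → F) :=
      (ω.1 ∘ Equiv.swap j k,
        E.symm (E ω.2 + s k (eY (ω.1 k) - G (E ω.2)) - s j (eY (ω.1 k) - G (E ω.2))))
    have hΨΨ : ∀ j k ω, Ψ k j (Ψ j k ω) = ω := by
      intro j k ω
      refine Prod.ext ?_ ?_
      · funext i
        simp [Ψ, Equiv.swap_comm k j]
      · simp [Ψ, hs]
    -- All atoms have the same mass, so every bijection preserves `μ`.
    have hμ : ∀ ω, μ {ω} = (νW {fun _ => Classical.arbitrary F}) ^ K *
        νZ {fun _ _ => Classical.arbitrary F} := by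
      rintro ⟨w, z⟩
      rw [← Set.singleton_prod_singleton, Measure.prod_prod, Measure.pi_singleton]
      simp [νW, νZ, uniformOn_univ]
    have hpres : μ.map (Ψ j k) = μ := by
      refine Measure.ext_of_singleton fun ω => ?_
      rw [Measure.map_apply .of_discrete (MeasurableSet.singleton _)]
      have : Ψ j k ⁻¹' {ω} = {Ψ k j ω} := by
        ext ω'
        simp only [Set.mem_preimage, Set.mem_singleton_iff]
        exact ⟨fun h => by rw [← h, hΨΨ], fun h => by rw [h, hΨΨ]⟩
      rw [this, hμ, hμ]
    have hcomp : (fun ω : (Fin K → Fin L → F) × (∀ n, Fin (D n) → F) =>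
        ((fun n => A k n ω), ω.1 k)) = (fun ω => ((fun n => A j n ω), ω.1 j)) ∘ Ψ j k := by
      funext ω
      have hE : ∀ z, e z = E z := fun z => rfl
      refine Prod.ext ?_ ?_
      · funext n
        simp [A, Ψ, hE, hs]
      · simp [Ψ]
    refine ⟨Measurable.aemeasurable .of_discrete, Measurable.aemeasurable .of_discrete, ?_⟩
    rw [hcomp, ← Measure.map_map .of_discrete .of_discrete, hpres]
/-- A finite field has arbitrarily large extensions, in the sense of cardinalities. -/
theorem exists_finite_field_card_pow (F : Type*) [Field F] [Finite F] (B : ℕ) :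
    ∃ (E : Type) (_ : Field E) (_ : Finite E) (t : ℕ), 1 ≤ t ∧ B ≤ Nat.card E ∧
      Nat.card E = Nat.card F ^ t := by
  have := Fintype.ofFinite F
  obtain ⟨p, _, n, hp, hcard⟩ := FiniteField.card' F
  have : Fact p.Prime := ⟨hp⟩
  have hne : (n : ℕ) * (B + 1) ≠ 0 := by positivity
  have hE : Nat.card (GaloisField p (n * (B + 1))) = Nat.card F ^ (B + 1) := by
    rw [GaloisField.card _ _ hne, Nat.card_eq_fintype_card, hcard, pow_mul]
  refine ⟨GaloisField p (n * (B + 1)), inferInstance, inferInstance, B + 1, by omega, ?_, hE⟩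
  rw [hE]
  exact ((Nat.lt_pow_self Finite.one_lt_card).trans
    (Nat.pow_lt_pow_right Finite.one_lt_card (Nat.lt_succ_self B))).le

/-- If every message is stored at servers that together may send `m` symbols, the rate
`m / ∑ n, d n` is achievable. -/
theorem pidAchievable_of_le_sum {F : Type} [Field F] [Finite F] [MeasurableSpace F]
    [DiscreteMeasurableSpace F] {K N M m : ℕ} (hMK : M ≤ K) (hm : 1 ≤ m)
    (T : Fin N → Finset (Fin K)) (hT : ∀ n, (T n).card ≤ M) (d : Fin N → ℕ)
    (hd : ∀ k, m ≤ ∑ n with k ∈ T n, d n) :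
    PIDAchievable F K N M ((m : ℝ) / ∑ n, (d n : ℝ)) := by
  classical
  obtain ⟨E, _, _, t, ht, hB, hE⟩ :=
    exists_finite_field_card_pow F (Nat.card (Σ n, Fin (d n)))
  -- The scheme needs only bijections with additive groups: `t` symbols of `F` are relabelled as one
  -- symbol of `E`.
  have equiv (a : ℕ) : Nonempty ((Fin (t * a) → F) ≃ (Fin a → E)) := by
    rw [← Finite.card_eq]
    simp only [Nat.card_fun, Nat.card_fin, hE, pow_mul]
  obtain ⟨b⟩ : Nonempty ((Σ n, Fin (d n)) ↪ E) := by
    have := Fintype.ofFinite E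
    refine Function.Embedding.nonempty_of_card_le ?_
    simpa only [Nat.card_eq_fintype_card] using hB
  have hS (n : Fin N) : ∃ S : Finset (Fin K), T n ⊆ S ∧ S.card = M := by
    obtain ⟨S, h1, -, h2⟩ := Finset.exists_subsuperset_card_eq (Finset.subset_univ (T n)) (hT n)
      (by simpa using hMK)
    exact ⟨S, h1, h2⟩
  choose S hTS hS using hS
  -- The evaluation points `b i` are distinct, so any `m` of the symbols can produce every value of
  -- `G`.
  let G : (∀ n, Fin (d n) → E) →+ (Fin m → E) :=
    { toFun := fun x j => ∑ i : Σ n, Fin (d n), x i.1 i.2 * b i ^ (j : ℕ)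
      map_zero' := by funext j; simp
      map_add' := fun x y => by funext j; simp [add_mul, Finset.sum_add_distrib] }
  have key : PIDAchievable F K N M (((t * m : ℕ) : ℝ) / ∑ n, ((t * d n : ℕ) : ℝ)) := by
    refine pidAchievable_of_addMonoidHom (Nat.mul_pos ht hm) S hS (fun n => t * d n)
      (fun n => (equiv (d n)).some) (equiv m).some G fun k y => ?_
    obtain ⟨c⟩ : Nonempty (Fin m ↪ {i : Σ n, Fin (d n) // k ∈ T i.1}) := by
      refine Function.Embedding.nonempty_of_card_le ?_
      rw [Fintype.card_fin, Fintype.card_subtype]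
      refine (hd k).trans_eq ?_
      have : (Finset.univ.filter fun i : Σ n, Fin (d n) => k ∈ T i.1) =
          (Finset.univ.filter fun n => k ∈ T n).sigma fun n => Finset.univ := by
        ext i
        simp
      simp [this]
    let V := Matrix.vandermonde fun j => b (c j).1
    have hV : V.det ≠ 0 := Matrix.det_vandermonde_ne_zero_iff.2
      (b.injective.comp (Subtype.val_injective.comp c.injective))
    obtain ⟨a, ha⟩ := Matrix.vecMul_surjective_iff_isUnit.2
      ((Matrix.isUnit_iff_isUnit_det V).2 hV.isUnit) y
    refine ⟨fun n i => ∑ j, if (c j).1 = ⟨n, i⟩ then a j else 0, fun n hn => ?_, ?_⟩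
    · funext i
      refine Finset.sum_eq_zero fun j _ => if_neg fun h => hn (hTS n ?_)
      have := (c j).2
      rwa [h] at this
    · rw [← ha]
      funext l
      simp only [G, AddMonoidHom.coe_mk, ZeroHom.coe_mk, Finset.sum_mul, Sigma.eta]
      rw [Finset.sum_comm]
      simp [Matrix.vecMul, dotProduct, V, Matrix.vandermonde_apply]
  convert key using 1
  push_cast
  rw [← Finset.mul_sum, mul_div_mul_left]
  exact_mod_cast (by omega : t ≠ 0)

/-! ### Storage designs -/

theorem card_filter_div_eq_le (K M n : ℕ) (hM : 1 ≤ M) :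
    (Finset.univ.filter fun k : Fin K => (k : ℕ) / M = n).card ≤ M := by
  calc _ ≤ (Finset.Ico (M * n) (M * n + M)).card := by
        refine Finset.card_le_card_of_injOn (fun k => (k : ℕ)) (fun k hk => ?_)
          Fin.val_injective.injOn
        simp only [Finset.coe_filter, Finset.mem_univ, true_and, Set.mem_ofPred_eq] at hk
        have h1 := Nat.div_add_mod (k : ℕ) M
        have h2 := Nat.mod_lt (k : ℕ) hM
        rw [hk] at h1
        simp only [Finset.coe_Ico, Set.mem_Ico]
        omega
    _ = M := by simp

/-- A window of one full period meets each residue once. In the cyclic design this counts both the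
messages at a server and the servers of a message. -/
theorem card_Ico_filter_mod_lt (n : ℕ) {a b : ℕ} (hba : b ≤ a) :
    ((Finset.Ico n (n + a)).filter fun x => x % a < b).card = b := by
  rw [Nat.filter_Ico_card_eq_of_periodic n a _ (fun x => by simp), Nat.count_eq_card_filter_range]
  have : (Finset.range a).filter (fun x => x % a < b) = Finset.range b := by
    ext x
    simp only [Finset.mem_filter, Finset.mem_range]
    refine ⟨fun ⟨h1, h2⟩ => by rwa [Nat.mod_eq_of_lt h1] at h2, fun h => ?_⟩
    have hx := h.trans_le hba
    exact ⟨hx, by rwa [Nat.mod_eq_of_lt hx]⟩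
  simp [this]

/-- The first `q` servers store disjoint blocks of `g * m` messages, and `m + r` further servers
store the remaining `g * (m + r)` messages cyclically. -/
theorem pidAchievable_blocks_cyclic {F : Type} [Field F] [Finite F] [MeasurableSpace F]
    [DiscreteMeasurableSpace F] {g m r q N : ℕ} (hg : 1 ≤ g) (hm : 1 ≤ m)
    (hN : q + (m + r) ≤ N) :
    PIDAchievable F (g * (q * m + (m + r))) N (g * m) ((m : ℝ) / (q * m + (m + r) : ℕ)) := by
  classical
  have hgm : 1 ≤ g * m := Nat.mul_pos hg hm
  have hmr : 1 ≤ m + r := by omega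
  set K := g * (q * m + (m + r)) with hK
  have hK' : K = q * (g * m) + g * (m + r) := by rw [hK]; ring
  let T (n : Fin N) : Finset (Fin K) :=
    if (n : ℕ) < q then Finset.univ.filter fun k => (k : ℕ) / (g * m) = n
    else if (n : ℕ) < q + (m + r) then Finset.univ.filter fun k => q * (g * m) ≤ (k : ℕ) ∧
      ((k : ℕ) - q * (g * m) + g * (n - q)) % (g * (m + r)) < g * m
    else ∅
  -- A block server is the only holder of its messages and sends all `m` symbols; cyclic servers
  -- send one each, surplus servers none.
  let d (n : ℕ) : ℕ := if n < q then m else if n < q + (m + r) then 1 else 0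
  have hsum : ∑ n : Fin N, d n = q * m + (m + r) := by
    obtain ⟨s, rfl⟩ := Nat.exists_eq_add_of_le hN
    rw [Fin.sum_univ_eq_sum_range, Finset.sum_range_add, Finset.sum_range_add]
    have h1 : ∑ x ∈ Finset.range q, d x = q * m := by
      rw [Finset.sum_congr rfl fun x hx => if_pos (Finset.mem_range.1 hx)]
      simp
    have h2 : ∑ x ∈ Finset.range (m + r), d (q + x) = m + r := by
      rw [Finset.sum_congr rfl fun x hx => show d (q + x) = 1 by
        have := Finset.mem_range.1 hx
        simp [d, this]]
      simp
    have h3 : ∑ x ∈ Finset.range s, d (q + (m + r) + x) = 0 :=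
      Finset.sum_eq_zero fun x _ => by
        simp only [d]
        rw [if_neg (by omega), if_neg (by omega)]
    rw [h1, h2, h3, add_zero]
  have main : PIDAchievable F K N (g * m) ((m : ℝ) / ∑ n : Fin N, (d n : ℝ)) := by
    refine pidAchievable_of_le_sum (T := T) (Nat.mul_le_mul_left g (by omega)) hm (fun n => ?_)
      (fun n => d n) (fun k => ?_)
    · simp only [T]
      split_ifs with h1 h2
      · exact card_filter_div_eq_le K (g * m) n hgm
      · set o := g * ((n : ℕ) - q)
        calc _ ≤ ((Finset.Ico o (o + g * (m + r))).filter
              fun x => x % (g * (m + r)) < g * m).card := by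
              refine Finset.card_le_card_of_injOn (fun k => (k : ℕ) - q * (g * m) + o)
                (fun k hk => ?_) (fun k hk k' hk' h => ?_)
              · simp only [Finset.coe_filter, Finset.mem_univ, true_and, Set.mem_ofPred_eq] at hk
                have := k.2
                simp only [Finset.coe_filter, Finset.mem_Ico, Set.mem_ofPred_eq]
                refine ⟨?_, hk.2⟩
                omega
              · simp only [Finset.coe_filter, Finset.mem_univ, true_and, Set.mem_ofPred_eq]
                  at hk hk' h
                apply Fin.ext
                omega
          _ = g * m := card_Ico_filter_mod_lt o (Nat.mul_le_mul_left g (by omega))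
      · simp
    · by_cases hk : (k : ℕ) / (g * m) < q
      · let n : Fin N := ⟨(k : ℕ) / (g * m), by omega⟩
        have hn : d n = m := if_pos hk
        refine hn.symm.le.trans (Finset.single_le_sum (f := fun n : Fin N => d n)
          (fun _ _ => Nat.zero_le _) ?_)
        simp [T, n, hk]
      · have hkq : q * (g * m) ≤ (k : ℕ) := by
          rw [← Nat.le_div_iff_mul_le hgm]
          omega
        set c := (k : ℕ) - q * (g * m)
        let U : Finset (Fin N) :=
          Finset.univ.filter fun n => k ∈ T n ∧ q ≤ (n : ℕ) ∧ (n : ℕ) < q + (m + r)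
        have hU : U.card = ∑ n ∈ U, d n := by
          rw [Finset.card_eq_sum_ones]
          refine Finset.sum_congr rfl fun n hn => ?_
          have := (Finset.mem_filter.1 hn).2.2
          simp only [d]
          rw [if_neg (by omega), if_pos (by omega)]
        -- Cyclic server `q + i` stores `k` when `(c / g + i) % (m + r) < m`, and `c / g + i` runs
        -- through one full period.
        calc m = ((Finset.Ico (c / g) (c / g + (m + r))).filter
              fun x => x % (m + r) < m).card := (card_Ico_filter_mod_lt _ (by omega)).symm
          _ ≤ U.card := by
              refine Finset.card_le_card_of_surjOn (fun n => (n : ℕ) - q + c / g)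
                fun x hx => ?_
              simp only [Finset.coe_filter, Finset.mem_Ico, Set.mem_ofPred_eq] at hx
              obtain ⟨⟨h1, h2⟩, h3⟩ := hx
              have hlt : q + (x - c / g) < q + (m + r) := by omega
              refine ⟨⟨q + (x - c / g), by omega⟩, ?_, ?_⟩
              · have hxc : (c + g * (x - c / g)) / g = x := by
                  rw [Nat.add_mul_div_left _ _ hg]
                  omega
                have : (c + g * (x - c / g)) % (g * (m + r)) < g * m := by
                  rw [Nat.mod_mul, hxc]
                  have h4 : (c + g * (x - c / g)) % g < g := Nat.mod_lt _ hg
                  calc _ < g + g * (x % (m + r)) := by omega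
                    _ = g * (x % (m + r) + 1) := by ring
                    _ ≤ g * m := Nat.mul_le_mul_left g h3
                simp only [U, T, Finset.coe_filter, Finset.mem_univ, true_and, Set.mem_ofPred_eq]
                rw [if_neg (by omega), if_pos hlt]
                refine ⟨?_, by omega, hlt⟩
                simp only [Finset.mem_filter, Finset.mem_univ, true_and, Nat.add_sub_cancel_left]
                exact ⟨hkq, this⟩
              · simp only [Nat.add_sub_cancel_left]
                omega
          _ = ∑ n ∈ U, d n := hU
          _ ≤ _ := Finset.sum_le_sum_of_subset fun n hn =>
              Finset.mem_filter.2 ⟨Finset.mem_univ _, (Finset.mem_filter.1 hn).2.1⟩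
  rw [← hsum]
  push_cast
  exact main

/-! ### Upper bounds on the rate -/

/-- Double counting of the pairs (message, server storing it), weighted by `D n`. -/
theorem IsPIDScheme.card_mul_length_le {F Ω 𝒵 : Type*} [Finite F] [Nontrivial F]
    [MeasurableSpace F] [DiscreteMeasurableSpace F] [MeasurableSpace Ω] [MeasurableSpace 𝒵]
    [Countable 𝒵] [DiscreteMeasurableSpace 𝒵] {K N M L : ℕ} {μ : Measure Ω}
    [IsProbabilityMeasure μ] {S : Fin N → Finset (Fin K)} {D : Fin N → ℕ}
    {W : Fin K → Ω → Fin L → F} {Z : Ω → 𝒵} {A : Fin K → (n : Fin N) → Ω → Fin (D n) → F}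
    (h : IsPIDScheme K N M L μ S D W Z A) : K * L ≤ M * ∑ n, D n := by
  classical
  calc K * L = ∑ _k : Fin K, L := by simp
    _ ≤ ∑ k, ∑ n with k ∈ S n, D n := Finset.sum_le_sum fun k _ => h.length_le k
    _ = ∑ n, ∑ k ∈ S n, D n := Finset.sum_comm' (by simp)
    _ = M * ∑ n, D n := by simp [h.card_storage, Finset.mul_sum]

/-- If no `N - 1` servers can store all the messages, every server sends at least as many symbols
as a message has. -/
theorem IsPIDScheme.length_le_of_lt {F Ω 𝒵 : Type*} [Finite F] [Nontrivial F]
    [MeasurableSpace F] [DiscreteMeasurableSpace F] [MeasurableSpace Ω] [MeasurableSpace 𝒵]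
    [Countable 𝒵] [DiscreteMeasurableSpace 𝒵] {K N M L : ℕ} {μ : Measure Ω}
    [IsProbabilityMeasure μ] {S : Fin N → Finset (Fin K)} {D : Fin N → ℕ}
    {W : Fin K → Ω → Fin L → F} {Z : Ω → 𝒵} {A : Fin K → (n : Fin N) → Ω → Fin (D n) → F}
    (h : IsPIDScheme K N M L μ S D W Z A) (hN : (N - 1) * M < K) (n : Fin N) : L ≤ D n := by
  classical
  have hcard : ((Finset.univ.erase n).biUnion S).card < K := by
    refine (Finset.card_biUnion_le_card_mul _ _ M fun i _ => (h.card_storage i).le).trans_lt ?_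
    simpa using hN
  obtain ⟨k, hk⟩ : ∃ k, k ∉ (Finset.univ.erase n).biUnion S := by
    by_contra! hc
    rw [Finset.eq_univ_iff_forall.2 hc] at hcard
    simp at hcard
  calc L ≤ ∑ i with k ∈ S i, D i := h.length_le k
    _ ≤ ∑ i ∈ {n}, D i := by
        refine Finset.sum_le_sum_of_subset fun i hi => ?_
        by_contra hin
        simp only [Finset.mem_singleton] at hin
        exact hk (Finset.mem_biUnion.2 ⟨i, by simpa using hin, (Finset.mem_filter.1 hi).2⟩)
    _ = D n := by simp

/-- If every PID scheme satisfies `a * L ≤ b * ∑ n, D n`, no rate above `b / a` is achievable. -/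
theorem PIDAchievable.le_div {F : Type*} [MeasurableSpace F] {K N M : ℕ} {R : ℝ}
    (hR : PIDAchievable F K N M R) {a b : ℕ} (ha : 1 ≤ a)
    (h : ∀ (L : ℕ) (S : Fin N → Finset (Fin K)) (D : Fin N → ℕ) (Ω 𝒵 : Type)
      (_ : MeasurableSpace Ω) (_ : MeasurableSpace 𝒵) (μ : Measure Ω)
      (W : Fin K → Ω → Fin L → F) (Z : Ω → 𝒵) (A : Fin K → (n : Fin N) → Ω → Fin (D n) → F),
      IsProbabilityMeasure μ → Countable 𝒵 → DiscreteMeasurableSpace 𝒵 →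
      IsPIDScheme K N M L μ S D W Z A → a * L ≤ b * ∑ n, D n) :
    R ≤ (b : ℝ) / a := by
  obtain ⟨L, S, D, Ω, 𝒵, _, _, μ, W, Z, A, -, hμ, h𝒵, h𝒵', hA, hR⟩ := hR
  refine hR.trans ?_
  have key := h L S D Ω 𝒵 _ _ μ W Z A hμ h𝒵 h𝒵' hA
  have ha' : (0 : ℝ) < a := by exact_mod_cast ha
  have hD : (0 : ℝ) ≤ ∑ n, (D n : ℝ) := Finset.sum_nonneg fun _ _ => Nat.cast_nonneg _
  -- This also covers `∑ n, D n = 0`, where the quotient is `0`.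
  refine div_le_of_le_mul₀ hD (by positivity) ?_
  rw [div_mul_eq_mul_div, le_div_iff₀ ha', mul_comm]
  exact_mod_cast key

theorem theorem2 (F : Type) [Field F] [Finite F] [MeasurableSpace F] [DiscreteMeasurableSpace F]
    (K N M : ℕ) (hM : 1 ≤ M) (hMK : M ≤ K) (hKM : ¬ M ∣ K) (hN : ⌈(K : ℝ) / M⌉₊ ≤ N) :
    ((K : ℝ) / Nat.gcd K M - ((M : ℝ) / Nat.gcd K M - 1) * ((⌊(K : ℝ) / M⌋₊ : ℝ) - 1) ≤ N →
      IsGreatest {R : ℝ | PIDAchievable F K N M R} ((M : ℝ) / K)) ∧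
    (N = ⌈(K : ℝ) / M⌉₊ →
      IsGreatest {R : ℝ | PIDAchievable F K N M R} (1 / (⌈(K : ℝ) / M⌉₊ : ℝ))) := by
  classical
  refine ⟨fun h => ⟨?_, fun R hR => ?_⟩, fun h => ?_⟩
  · rw [Nat.floor_div_natCast, Nat.floor_natCast] at h
    have hg : 1 ≤ Nat.gcd K M := Nat.gcd_pos_of_pos_right _ hM
    obtain ⟨K', hK'⟩ := Nat.gcd_dvd_left K M
    obtain ⟨m, hm'⟩ := Nat.gcd_dvd_right K M
    set g := Nat.gcd K M
    clear_value g
    subst hK' hm'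
    have hg' : (g : ℝ) ≠ 0 := by exact_mod_cast (by omega : g ≠ 0)
    have hm : 1 ≤ m := Nat.pos_of_mul_pos_left hM
    have hmK : m ≤ K' := Nat.le_of_mul_le_mul_left hMK hg
    obtain ⟨q, hq⟩ : ∃ q, K' / m = q + 1 :=
      Nat.exists_eq_add_of_le' ((Nat.one_le_div_iff hm).2 hmK)
    have hdiv := Nat.div_add_mod K' m
    rw [hq] at hdiv
    rw [Nat.mul_div_mul_left _ _ hg, hq] at h
    set r := K' % m
    clear_value r
    have hK : K' = q * m + (m + r) := by rw [← hdiv]; ring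
    subst hK
    -- With `⌊K / M⌋ = q + 1`, the threshold is `q * m + (m + r) - (m - 1) * q = q + (m + r)`.
    have hN' : q + (m + r) ≤ N := by
      push_cast at h
      rw [mul_div_cancel_left₀ _ hg', mul_div_cancel_left₀ _ hg'] at h
      have : ((q + (m + r) : ℕ) : ℝ) ≤ N := by
        push_cast
        linarith
      exact_mod_cast this
    have := pidAchievable_blocks_cyclic (F := F) hg hm hN'
    rw [Set.mem_ofPred_eq]
    convert this using 1
    push_cast
    rw [mul_div_mul_left _ _ hg']
  · exact hR.le_div (by omega) fun L S D Ω 𝒵 _ _ μ W Z A _ _ _ hA => hA.card_mul_length_le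
  · rw [← h]
    have hM' : (0 : ℝ) < M := by exact_mod_cast hM
    have hlt : (N - 1) * M < K := by
      have hN0 : N - 1 < ⌈(K : ℝ) / M⌉₊ := by
        have : 0 < ⌈(K : ℝ) / M⌉₊ := Nat.ceil_pos.2 (div_pos (by exact_mod_cast hM.trans hMK) hM')
        omega
      rw [Nat.lt_ceil, lt_div_iff₀ hM'] at hN0
      exact_mod_cast hN0
    have hle : K ≤ N * M := by
      have := h.symm.le
      rw [Nat.ceil_le, div_le_iff₀ hM'] at this
      exact_mod_cast this
    have hN1 : 1 ≤ N := by
      rcases Nat.eq_zero_or_pos N with rfl | h0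
      · omega
      · exact h0
    refine ⟨?_, fun R hR => ?_⟩
    -- Consecutive blocks of at most `M` messages, one per server, each server sending one symbol.
    · have := pidAchievable_of_le_sum (F := F) (N := N) hMK le_rfl
        (fun n => Finset.univ.filter fun k : Fin K => (k : ℕ) / M = n)
        (fun n => card_filter_div_eq_le K M n hM) (fun _ => 1) fun k => by
          have hk : (k : ℕ) / M < N := (Nat.div_lt_iff_lt_mul hM).2 (k.2.trans_le hle)
          refine Finset.single_le_sum (f := fun _ : Fin N => 1) (a := ⟨_, hk⟩)
            (fun _ _ => Nat.zero_le _) ?_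
          simp
      simpa using this
    · refine (hR.le_div hN1 (b := 1) fun L S D Ω 𝒵 _ _ μ W Z A _ _ _ hA => ?_).trans_eq (by simp)
      calc N * L = ∑ _n : Fin N, L := by simp
        _ ≤ ∑ n, D n := Finset.sum_le_sum fun n _ => hA.length_le_of_lt hlt n
        _ = 1 * ∑ n, D n := (one_mul _).symm
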